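/- Let $\mathcal E=(E,\ast)$ be a finite biordered set, that is, a partial algebra with $E$ finite that is isomorphic to the biordered set $\mathcal E_S$ of idempotents of some (possibly infinite) semigroup $S$. Here $\mathcal E_S$ is the set $E(S)$ of idempotents of $S$ with the partial operation $e\ast f=ef$, defined exactly when $\{e,f\}$ is a basic pair, i.e. when $\{e,f\}\cap\{ef,fe\}\neq\varnothing$. Let $$\mathrm{IG}(\mathcal E)=\langle\, \overline{E} : \overline e\,\overline f=\overline{e\ast f}\ \text{whenever } e\ast f \text{ is defined}\,\rangle$$ be the free idempotent generated semigroup over $\mathcal E$, given by this semigroup presentation with generating set $\overline E=\{\overline e: e\in E\}$ in bijection with $E$. On any semigroup $T$ with set of idempotents $E(T)$ define $$a\,\widetilde{\mathscr R}\,b \iff (\forall e\in E(T))\ (ea=a\Leftrightarrow eb=b),\qquad a\,\widetilde{\mathscr L}\,b \iff (\forall e\in E(T))\ (ae=a\Leftrightarrow be=b).$$ Then $\mathrm{IG}(\mathcal E)$ is a Fountain (weakly abundant) semigroup: every $\widetilde{\mathscr R}$-class and every $\widetilde{\mathscr L}$-class of $\mathrm{IG}(\mathcal E)$ contains an idempotent.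 Moreover, $\mathrm{IG}(\mathcal E)$ satisfies the congruence condition: $\widetilde{\mathscr R}$ is a left congruence and $\widetilde{\mathscr L}$ is a right congruence on $\mathrm{IG}(\mathcal E)$. -/

import Mathlib

universe u v

/-- The set `E(S)` of idempotents of a semigroup, as a type. -/
abbrev Idem (S : Type u) [Semigroup S] : Type u := {e : S // IsIdempotentElem e}

/-- `{e, f}` is a basic pair: `{e, f} ∩ {ef, fe} ≠ ∅`. -/
def IsBasicPair {S : Type u} [Semigroup S] (e f : S) : Prop :=
  (({e, f} : Set S) ∩ {e * f, f * e}).Nonempty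

/-- The product of a basic pair of idempotents is an idempotent. -/
theorem IsBasicPair.isIdempotentElem_mul {S : Type u} [Semigroup S] {e f : S}
    (he : IsIdempotentElem e) (hf : IsIdempotentElem f) (h : IsBasicPair e f) :
    IsIdempotentElem (e * f) := by
  unfold IsIdempotentElem at *
  obtain ⟨x, hx, hx'⟩ := h
  have key : e * f * (e * f) = e * (f * e) * f := by simp only [mul_assoc]
  rcases hx with rfl | rfl <;> rcases hx' with h | h
  · rw [← h, he]
  · rw [key, ← h, he]
  · rw [← h, hf]
  · rw [key, ← h, mul_assoc, hf]

/-- A partial binary operation on a type: `(op e f).Dom` says that the product `e ∗ f` is defined,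
and `g ∈ op e f` says that it is defined and equal to `g`. -/
abbrev PartialBinOp (E : Type u) : Type u := E → E → Part E

/-- The biordered set of idempotents `(E(S), ∗)` of a semigroup `S`: the product `e ∗ f` is defined
exactly when `{e, f}` is a basic pair, and then it is the product `ef` of `S`. -/
def biorder (S : Type u) [Semigroup S] : PartialBinOp (Idem S) := fun e f =>
  ⟨IsBasicPair (e : S) (f : S), fun h => ⟨(e : S) * f, h.isIdempotentElem_mul e.2 f.2⟩⟩

/-- A partial algebra `(E, ∗)` is a biordered set if it is isomorphic, as a partial algebra, to the
biordered set of idempotents of some semigroup. -/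
def IsBiorderedSet {E : Type u} (op : PartialBinOp E) : Prop :=
  ∃ (S : Type v) (_ : Semigroup S) (φ : E ≃ Idem S),
    ∀ e f g : E, g ∈ op e f ↔ φ g ∈ biorder S (φ e) (φ f)

/-- The defining relations `e f = e ∗ f` (whenever `e ∗ f` is defined) of the free idempotent
generated semigroup, as a relation between words over `E`. -/
def igRel {E : Type u} (op : PartialBinOp E) (x y : FreeSemigroup E) : Prop :=
  ∃ e f g : E, g ∈ op e f ∧
    x = FreeSemigroup.of e * FreeSemigroup.of f ∧ y = FreeSemigroup.of g

/-- The free idempotent generated semigroup `IG(E)`: the quotient of the free semigroup on `E` by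
the congruence generated by the defining relations. -/
abbrev IG {E : Type u} (op : PartialBinOp E) : Type u := (conGen (igRel op)).Quotient

/-- The relation `R̃` on a semigroup. -/
def RTilde {S : Type u} [Semigroup S] (a b : S) : Prop :=
  ∀ e : S, IsIdempotentElem e → (e * a = a ↔ e * b = b)

/-- The relation `L̃` on a semigroup. -/
def LTilde {S : Type u} [Semigroup S] (a b : S) : Prop :=
  ∀ e : S, IsIdempotentElem e → (a * e = a ↔ b * e = b)

/-- A Fountain (weakly abundant) semigroup: every `R̃`-class and every `L̃`-class contains an
idempotent. -/
def IsFountain (S : Type u) [Semigroup S] : Prop :=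
  (∀ a : S, ∃ e : S, IsIdempotentElem e ∧ RTilde a e) ∧
    ∀ a : S, ∃ e : S, IsIdempotentElem e ∧ LTilde a e

/-- A left congruence: an equivalence relation compatible with left multiplication. -/
def IsLeftCongruence {S : Type u} [Semigroup S] (r : S → S → Prop) : Prop :=
  Equivalence r ∧ ∀ a b c : S, r a b → r (c * a) (c * b)

/-- A right congruence: an equivalence relation compatible with right multiplication. -/
def IsRightCongruence {S : Type u} [Semigroup S] (r : S → S → Prop) : Prop :=
  Equivalence r ∧ ∀ a b c : S, r a b → r (a * c) (b * c)

/-- The congruence condition: `R̃` is a left congruence and `L̃` is a right congruence. -/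
def CongruenceCondition (S : Type u) [Semigroup S] : Prop :=
  IsLeftCongruence (RTilde (S := S)) ∧ IsRightCongruence (LTilde (S := S))

/-! Let `S` realise the biordered set. Read a word from right to left, tracking an `R`-class of
idempotents of `S`: a letter `e` sends the class of `h` to that of `e h` if `h` can be chosen in its
class with `h e = h`, and otherwise resets the class to that of `e`. By `act_act` this respects the
defining relations, so every element `a` acquires an idempotent `g` with `ι g * a = a`
(`exists_represents`).

The crux is `Represents.mul_eq`: an idempotent `c` with `c * b = b` fixes `ι g`, for the `g`
attached to `b`. To see this, a counter is added for each rank `d`, counting resets of rank `d` and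
returning to zero at resets of smaller rank. It too respects the relations, since rank (a natural
number because `E` is finite) is strictly monotone in the `L`- and `R`-orders. If `c` caused a reset
on the class of `g`, the counter for the least rank of a reset would grow, against `c * b = b`.
Without resets, `c * ι g` is `L`-related to `ι g` and fixed by `ι g` on the left, hence idempotent
and equal to `ι g`.

So `b` is `R̃`-related to `ι g`. The class attached to `c * a` depends only on `c` and the class
attached to `a` (`rTilde_mul`), which yields the left congruence. The claims for `L̃` follow in the
opposite semigroup. -/

namespace Idem

variable {S : Type v} [Semigroup S]

/-- The product of a basic pair of idempotents, as an idempotent. -/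
def mul (e f : Idem S) (h : IsBasicPair (e : S) (f : S)) : Idem S :=
  ⟨(e : S) * f, h.isIdempotentElem_mul e.2 f.2⟩

theorem mul_self (e : Idem S) : (e : S) * e = e := e.2

theorem mul_self_mul (e : Idem S) (a : S) : (e : S) * (e * a) = e * a := by
  rw [← mul_assoc, e.mul_self]

theorem basic_of_mul_eq_left {e f : Idem S} (h : (e : S) * f = e) :
    IsBasicPair (e : S) (f : S) := ⟨e, by simp, by simp [h]⟩

theorem basic_of_mul_eq_right {e f : Idem S} (h : (e : S) * f = f) :
    IsBasicPair (e : S) (f : S) := ⟨f, by simp, by simp [h]⟩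

theorem basic_of_swap_eq_left {e f : Idem S} (h : (f : S) * e = e) :
    IsBasicPair (e : S) (f : S) := ⟨e, by simp, by simp [h]⟩

theorem basic_of_swap_eq_right {e f : Idem S} (h : (f : S) * e = f) :
    IsBasicPair (e : S) (f : S) := ⟨f, by simp, by simp [h]⟩

theorem basic_cases {e f : Idem S} (h : IsBasicPair (e : S) (f : S)) :
    (e : S) * f = e ∨ (e : S) * f = f ∨ (f : S) * e = f ∨ (f : S) * e = e := by
  obtain ⟨x, hx, hx'⟩ := h
  rcases hx with rfl | rfl <;> rcases hx' with h | h
  · exact Or.inl h.symm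
  · exact Or.inr (Or.inr (Or.inr h.symm))
  · exact Or.inr (Or.inl h.symm)
  · exact Or.inr (Or.inr (Or.inl h.symm))

/-- Green's relation `R` on the idempotents of a semigroup. -/
def rSetoid (S : Type v) [Semigroup S] : Setoid (Idem S) where
  r e f := (e : S) * f = f ∧ (f : S) * e = e
  iseqv :=
    { refl := fun e => ⟨e.2, e.2⟩
      symm := fun h => ⟨h.2, h.1⟩
      trans := fun {e f g} h k =>
        ⟨by rw [← k.1, ← mul_assoc, h.1], by rw [← h.2, ← mul_assoc, k.2]⟩ }

/-- The set of `R`-classes of idempotents. -/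
abbrev RClass (S : Type v) [Semigroup S] : Type v := Quotient (rSetoid S)

/-- The `R`-class of an idempotent. -/
def rClass (e : Idem S) : RClass S := Quotient.mk (rSetoid S) e

theorem rClass_eq_iff {e f : Idem S} :
    rClass e = rClass f ↔ (e : S) * f = f ∧ (f : S) * e = e :=
  ⟨fun h => Quotient.exact (s := rSetoid S) h, fun h => Quotient.sound (s := rSetoid S) h⟩

/-- The idempotents below a given one in the natural order. -/
def lower (e : Idem S) : Set S :=
  {x | IsIdempotentElem x ∧ (e : S) * x = x ∧ x * e = x}

/-- The number of idempotents below a given one in the natural order. -/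
noncomputable def rank (e : Idem S) : ℕ := (lower e).ncard

/-! ### Monotonicity of rank in the `L`- and `R`-orders. -/

section Rank

variable [Finite (Idem S)]

theorem finite_lower (e : Idem S) : (lower e).Finite :=
  (Set.finite_coe_iff.1 ‹Finite (Idem S)›).subset fun _ hx => hx.1

/-- Left multiplication by `f` injects `lower e` into `lower f`; left multiplication by `e` undoes
it. -/
theorem rank_le_of_mul_eq_left {e f : Idem S} (h : (e : S) * f = e) : rank e ≤ rank f := by
  refine Set.ncard_le_ncard_of_injOn (fun x => (f : S) * x) ?_ ?_ (finite_lower f)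
  · rintro x ⟨hx0, _, hx⟩
    have hx' : x * f = x := by rw [← hx, mul_assoc, h]
    have hfx : (f : S) * x * f = f * x := by rw [mul_assoc, hx']
    exact ⟨by unfold IsIdempotentElem; rw [← mul_assoc, hfx, mul_assoc, hx0],
      f.mul_self_mul _, hfx⟩
  · rintro x ⟨_, hx, _⟩ y ⟨_, hy, _⟩ hxy
    rw [← hx, ← hy, ← h, mul_assoc, mul_assoc]
    exact congrArg _ hxy

theorem rank_le_of_mul_eq_right {e f : Idem S} (h : (f : S) * e = e) : rank e ≤ rank f := by
  refine Set.ncard_le_ncard_of_injOn (fun x => x * (f : S)) ?_ ?_ (finite_lower f)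
  · rintro x ⟨hx0, hx, _⟩
    have hx' : (f : S) * x = x := by rw [← hx, ← mul_assoc, h]
    have hfx : (f : S) * (x * f) = x * f := by rw [← mul_assoc, hx']
    exact ⟨by unfold IsIdempotentElem; rw [mul_assoc, hfx, ← mul_assoc, hx0],
      hfx, by rw [mul_assoc, f.mul_self]⟩
  · rintro x ⟨_, _, hx⟩ y ⟨_, _, hy⟩ hxy
    rw [← hx, ← hy, ← h, ← mul_assoc, ← mul_assoc]
    exact congrArg (· * (e : S)) hxy

theorem rank_lt_of_le {e f : Idem S} (h1 : (e : S) * f = e) (h2 : (f : S) * e = e)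
    (hne : e ≠ f) : rank e < rank f := by
  refine Set.ncard_lt_ncard ⟨?_, fun hsub => hne ?_⟩ (finite_lower f)
  · rintro x ⟨hx0, hx, hx'⟩
    exact ⟨hx0, by rw [← hx, ← mul_assoc, h2], by rw [← hx', mul_assoc, h1]⟩
  · exact Subtype.ext (h1.symm.trans (hsub ⟨f.2, f.2, f.2⟩).2.1)

/-- The idempotent `f e` is strictly below `f` in the natural order, and `e` is `L`-below `f e`. -/
theorem rank_lt_of_mul_eq_left {e f : Idem S} (h : (e : S) * f = e) (hne : (f : S) * e ≠ f) :
    rank e < rank f := by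
  have hfe : (f : S) * e * f = f * e := by rw [mul_assoc, h]
  refine lt_of_le_of_lt (rank_le_of_mul_eq_left (f := mul f e (basic_of_swap_eq_right h)) ?_)
    (rank_lt_of_le (e := mul f e (basic_of_swap_eq_right h)) ?_ ?_ ?_)
  · simp only [mul]
    rw [← mul_assoc, h, e.mul_self]
  · exact hfe
  · exact f.mul_self_mul _
  · exact fun h' => hne (congrArg Subtype.val h')

theorem rank_lt_of_mul_eq_right {e f : Idem S} (h : (f : S) * e = e) (hne : (e : S) * f ≠ f) :
    rank e < rank f := by
  refine lt_of_le_of_lt (rank_le_of_mul_eq_right (f := mul e f (basic_of_swap_eq_left h)) ?_)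
    (rank_lt_of_le (e := mul e f (basic_of_swap_eq_left h)) ?_ ?_ ?_)
  · simp only [mul]
    rw [mul_assoc, h, e.mul_self]
  · simp only [mul]
    rw [mul_assoc, f.mul_self]
  · simp only [mul]
    rw [← mul_assoc, h]
  · exact fun h' => hne (congrArg Subtype.val h')

theorem rank_eq_of_rClass_eq {e f : Idem S} (h : rClass e = rClass f) : rank e = rank f :=
  le_antisymm (rank_le_of_mul_eq_right (rClass_eq_iff.1 h).2)
    (rank_le_of_mul_eq_right (rClass_eq_iff.1 h).1)

end Rank

/-! ### The action on `R`-classes with a counter. -/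

/-- An idempotent acts regularly on an `R`-class if it is `L`-above some member of it. -/
def Strong (e : Idem S) (X : Option (RClass S)) : Prop :=
  ∃ h : Idem S, X = some (rClass h) ∧ (h : S) * e = h

/-- The update of the counter, when the `R`-class is reset to that of an idempotent of rank `n`:
resets of rank `d` are counted since the last one of smaller rank. -/
def bump (d n k : ℕ) : ℕ := if n < d then 0 else if n = d then k + 1 else k

/-- A relation may absorb a reset into a following one of smaller rank. The counter does not notice:
either `n ≤ d`, and the second reset zeroes it, or `d < n`, and the first left it alone. -/
theorem bump_bump {d m n : ℕ} (h : m < n) (k : ℕ) : bump d m (bump d n k) = bump d m k := by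
  unfold bump
  split_ifs <;> omega

open Classical in
/-- The left action of an idempotent on an `R`-class with a counter. If the action is not regular,
the class is reset to that of the idempotent, and the counter is updated. -/
noncomputable def act (d : ℕ) (e : Idem S) (p : Option (RClass S) × ℕ) : Option (RClass S) × ℕ :=
  if H : Strong e p.1 then
    (some (rClass (mul e H.choose (basic_of_swap_eq_right H.choose_spec.2))), p.2)
  else (some (rClass e), bump d (rank e) p.2)

/-- Independence of the chosen representative: if `h`, `h'` are `R`-related and both `L`-below `e`,
then `e h` and `e h'` are `R`-related. -/
theorem act_of_mul_eq (d : ℕ) {e h : Idem S} (he : (h : S) * e = h) (k : ℕ) :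
    act d e (some (rClass h), k) =
      (some (rClass (mul e h (basic_of_swap_eq_right he))), k) := by
  have H : Strong e (some (rClass h)) := ⟨h, rfl, he⟩
  unfold act
  rw [dif_pos H]
  have h1 := rClass_eq_iff.1 (Option.some.inj H.choose_spec.1)
  have h2 := H.choose_spec.2
  refine Prod.ext (congrArg some (rClass_eq_iff.2 ?_)) rfl
  simp only [mul]
  constructor
  · rw [mul_assoc, ← mul_assoc (H.choose : S), h2, h1.2]
  · rw [mul_assoc, ← mul_assoc (h : S), he, h1.1]

theorem act_of_mul_eq' (d : ℕ) {e h g : Idem S} (he : (h : S) * e = h) (hg : (g : S) = e * h)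
    (k : ℕ) : act d e (some (rClass h), k) = (some (rClass g), k) := by
  rw [act_of_mul_eq d he]
  congr 3
  exact Subtype.ext hg.symm

theorem act_of_not_strong (d : ℕ) {e : Idem S} {X : Option (RClass S)} (H : ¬ Strong e X) (k : ℕ) :
    act d e (X, k) = (some (rClass e), bump d (rank e) k) := dif_neg H

/-- An idempotent that is `R`-above an `R`-class fixes it. -/
theorem act_of_mul_eq_right (d : ℕ) {e y : Idem S} (h : (e : S) * y = y) (k : ℕ) :
    act d e (some (rClass y), k) = (some (rClass y), k) := by
  have hb := basic_of_swap_eq_left h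
  have h1 : rClass y = rClass (mul y e hb) := by
    refine rClass_eq_iff.2 ⟨y.mul_self_mul _, ?_⟩
    simp only [mul]
    rw [mul_assoc, h, y.mul_self]
  conv_lhs => rw [h1]
  rw [act_of_mul_eq' d (h := mul y e hb) (g := mul y e hb), h1]
  · simp only [mul]
    rw [mul_assoc, e.mul_self]
  · simp only [mul]
    rw [← mul_assoc, h]

theorem exists_act_eq (d : ℕ) (e : Idem S) (X : Option (RClass S)) (k : ℕ) :
    ∃ (y : Idem S) (k' : ℕ), act d e (X, k) = (some (rClass y), k') ∧ (e : S) * y = y := by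
  by_cases H : Strong e X
  · obtain ⟨h, rfl, he⟩ := H
    exact ⟨_, k, act_of_mul_eq d he k, e.mul_self_mul _⟩
  · exact ⟨e, _, act_of_not_strong d H k, e.2⟩

/-- If `f` acts regularly on the `R`-class of `h`, then what acts regularly on the image comes from
what acts regularly on the `R`-class of `h`. -/
theorem exists_of_strong_mul {e f h y : Idem S} (hf : (h : S) * f = h) (hy : (y : S) = f * h)
    (hi : IsIdempotentElem ((e : S) * f)) (H : Strong e (some (rClass y))) :
    ∃ x : Idem S, rClass x = rClass h ∧ (x : S) * (e * f) = x := by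
  obtain ⟨k, hk, hke⟩ := H
  obtain ⟨h1, h2⟩ := rClass_eq_iff.1 (Option.some.inj hk)
  rw [hy] at h1 h2
  have key : (h : S) * k * f * h = h := by
    rw [mul_assoc, mul_assoc, h2, ← mul_assoc, hf, h.mul_self]
  refine ⟨⟨(h : S) * k * f, ?_⟩, rClass_eq_iff.2 ⟨key, ?_⟩, ?_⟩
  · unfold IsIdempotentElem
    rw [← mul_assoc, ← mul_assoc, key]
  · simp only
    rw [← mul_assoc, h.mul_self_mul]
  · have hkf : (k : S) * f = k * (e * f) := by rw [← mul_assoc, hke]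
    simp only
    rw [mul_assoc (h : S), hkf, mul_assoc, mul_assoc, hi]

theorem act_act_of_mul_eq_right (d : ℕ) {e f : Idem S} (hef : (e : S) * f = f)
    (p : Option (RClass S) × ℕ) : act d e (act d f p) = act d f p := by
  obtain ⟨y, k', h, hy⟩ := exists_act_eq d f p.1 p.2
  rw [h, act_of_mul_eq_right]
  rw [← hy, ← mul_assoc, hef]

variable [Finite (Idem S)]

theorem act_act_of_mul_eq_left (d : ℕ) {e f : Idem S} (hef : (e : S) * f = e)
    (p : Option (RClass S) × ℕ) : act d e (act d f p) = act d e p := by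
  obtain ⟨X, k⟩ := p
  have hle : ∀ {x : Idem S}, (x : S) * e = x → (x : S) * f = x := fun {x} hx => by
    rw [← hx, mul_assoc, hef]
  by_cases He : Strong e X
  · obtain ⟨h, rfl, he⟩ := He
    have hf := hle he
    rw [act_of_mul_eq d hf, act_of_mul_eq d he, act_of_mul_eq' d]
    · simp only [mul]
      rw [mul_assoc, he]
    · simp only [mul]
      rw [← mul_assoc, hef]
  rw [act_of_not_strong d He]
  by_cases Hf : Strong f X
  · obtain ⟨h, rfl, hf⟩ := Hf
    rw [act_of_mul_eq d hf, act_of_not_strong]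
    intro H
    obtain ⟨x, hx, hxe⟩ := exists_of_strong_mul hf rfl (by rw [hef]; exact e.2) H
    exact He ⟨x, by rw [hx], by rwa [hef] at hxe⟩
  rw [act_of_not_strong d Hf]
  -- After the reset by `f`, the letter `e` acts regularly only if `e` and `f` are `L`-related,
  -- hence of equal rank; otherwise both letters reset, in decreasing rank.
  by_cases H : Strong e (some (rClass f))
  · obtain ⟨x, hx, hxe⟩ := H
    have hxf : f = x := Subtype.ext
      ((rClass_eq_iff.1 (Option.some.inj hx)).2.symm.trans (hle hxe))
    subst hxf
    rw [act_of_mul_eq' d hxe hef.symm, le_antisymm (rank_le_of_mul_eq_left hef)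
      (rank_le_of_mul_eq_left hxe)]
  · rw [act_of_not_strong d H, bump_bump]
    exact rank_lt_of_mul_eq_left hef fun h => H ⟨f, rfl, h⟩

/-- Here `g` is `L`-related to `f`, so both act regularly on the same classes and have the same
rank. -/
theorem act_act_of_swap_eq_right (d : ℕ) {e f g : Idem S} (hfe : (f : S) * e = f)
    (hg : (g : S) = e * f) (p : Option (RClass S) × ℕ) :
    act d e (act d f p) = act d g p := by
  obtain ⟨X, k⟩ := p
  have hfg : (f : S) * g = f := by rw [hg, ← mul_assoc, hfe, f.mul_self]
  have hgf : (g : S) * f = g := by rw [hg, mul_assoc, f.mul_self]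
  by_cases Hf : Strong f X
  · obtain ⟨h, rfl, hf⟩ := Hf
    have hhg : (h : S) * g = h := by rw [← hf, mul_assoc, hfg]
    rw [act_of_mul_eq d hf, act_of_mul_eq d hhg, act_of_mul_eq' d]
    · simp only [mul]
      conv_lhs => rw [← hf, ← mul_assoc, mul_assoc, hfe]
      rw [mul_assoc, hf]
    · simp only [mul]
      rw [hg, mul_assoc]
  · have Hg : ¬ Strong g X := by
      rintro ⟨x, hx, hxg⟩
      exact Hf ⟨x, hx, by rw [← hxg, mul_assoc, hgf]⟩
    rw [act_of_not_strong d Hf, act_of_not_strong d Hg, act_of_mul_eq' d hfe hg,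
      le_antisymm (rank_le_of_mul_eq_left hfg) (rank_le_of_mul_eq_left hgf)]

theorem act_act_of_swap_eq_left (d : ℕ) {e f g : Idem S} (hfe : (f : S) * e = e)
    (hg : (g : S) = e * f) (p : Option (RClass S) × ℕ) :
    act d e (act d f p) = act d g p := by
  obtain ⟨X, k⟩ := p
  have hgf : (g : S) * f = g := by rw [hg, mul_assoc, f.mul_self]
  have hge : (g : S) * e = e := by rw [hg, mul_assoc, hfe, e.mul_self]
  have heg : (e : S) * g = g := by rw [hg, e.mul_self_mul]
  have hcl : rClass e = rClass g := rClass_eq_iff.2 ⟨heg, hge⟩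
  have hle : ∀ {x : Idem S}, (x : S) * g = x → (x : S) * f = x := fun {x} hx => by
    rw [← hx, mul_assoc, hgf]
  by_cases Hg : Strong g X
  · obtain ⟨h, rfl, hhg⟩ := Hg
    have hf := hle hhg
    have hi : (f : S) * h * (f * h) = f * h := by
      rw [mul_assoc, ← mul_assoc (h : S), hf, h.mul_self]
    have hki : (f : S) * h * e * (f * h) = f * h := by
      rw [mul_assoc, ← mul_assoc (e : S), ← hg, mul_assoc, ← mul_assoc (h : S), hhg, h.mul_self]
    -- A member of the class of `f h` that is `L`-below `e`: it witnesses that `e` acts regularly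
    -- after `f`.
    let u : Idem S := ⟨(f : S) * h * e, by
      unfold IsIdempotentElem
      rw [← mul_assoc, hki]⟩
    have hu : (u : S) * e = u := by
      simp only [u]
      rw [mul_assoc, e.mul_self]
    have hcu : rClass (mul f h (basic_of_swap_eq_right hf)) = rClass u := by
      refine rClass_eq_iff.2 ⟨?_, hki⟩
      simp only [mul, u]
      rw [← mul_assoc, hi]
    rw [act_of_mul_eq d hf, act_of_mul_eq d hhg, hcu, act_of_mul_eq d hu]
    refine Prod.ext (congrArg some (rClass_eq_iff.2 ⟨?_, ?_⟩)) rfl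
    · simp only [mul, u]
      rw [hg, mul_assoc (e : S) f, mul_assoc (e : S), mul_assoc _ (e : S) (e * _),
        e.mul_self_mul, ← mul_assoc _ (e : S), hki]
    · simp only [mul, u]
      rw [hg, mul_assoc (e : S) f, mul_assoc (e : S), ← mul_assoc _ (e : S), ← mul_assoc _ _ (e : S),
        hki]
  rw [act_of_not_strong d Hg]
  by_cases Hf : Strong f X
  · obtain ⟨h, rfl, hf⟩ := Hf
    rw [act_of_mul_eq d hf, act_of_not_strong, hcl, rank_eq_of_rClass_eq hcl]
    intro H
    obtain ⟨x, hx, hxe⟩ := exists_of_strong_mul hf rfl (by rw [← hg]; exact g.2) H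
    exact Hg ⟨x, by rw [hx], by rwa [← hg] at hxe⟩
  rw [act_of_not_strong d Hf, ← hcl, ← rank_eq_of_rClass_eq hcl]
  -- Regular action of `e` on the class of `f` forces `e` and `f` to be `R`-related; otherwise `e`
  -- has smaller rank.
  by_cases H : Strong e (some (rClass f))
  · obtain ⟨x, hx, hxe⟩ := H
    obtain ⟨h1, h2⟩ := rClass_eq_iff.1 (Option.some.inj hx)
    have hxe' : x = e := Subtype.ext (by
      rw [← hxe, ← hfe, ← mul_assoc, h2, hfe])
    subst hxe'
    have hc := rClass_eq_iff.2 ⟨h1, h2⟩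
    rw [hc, act_of_mul_eq' d x.2 x.mul_self.symm, rank_eq_of_rClass_eq hc]
  · rw [act_of_not_strong d H, bump_bump]
    exact rank_lt_of_mul_eq_right hfe fun h => H ⟨e, by rw [rClass_eq_iff.2 ⟨hfe, h⟩], e.2⟩

theorem act_act (d : ℕ) {e f : Idem S} (h : IsBasicPair (e : S) (f : S))
    (p : Option (RClass S) × ℕ) : act d e (act d f p) = act d (mul e f h) p := by
  rcases basic_cases h with h' | h' | h' | h'
  · rw [act_act_of_mul_eq_left d h', show mul e f h = e from Subtype.ext h']
  · rw [act_act_of_mul_eq_right d h', show mul e f h = f from Subtype.ext h']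
  · exact act_act_of_swap_eq_right d h' rfl p
  · exact act_act_of_swap_eq_left d h' rfl p

end Idem

/-! ### `R̃` in the free idempotent generated semigroup. -/

/-- The properties of `IG(E(S))` used below: the generators satisfy the defining relations, they
generate, and the universal property holds. -/
structure IsFreeIG {S : Type v} [Semigroup S] {T : Type u} [Semigroup T] (ι : Idem S → T) :
    Prop where
  mul_of_basic : ∀ (e f : Idem S) (h : IsBasicPair (e : S) (f : S)), ι e * ι f = ι (e.mul f h)
  closure_eq : Subsemigroup.closure (Set.range ι) = ⊤
  exists_lift : ∀ (M : Type v) [Semigroup M] (j : Idem S → M),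
    (∀ (e f : Idem S) (h : IsBasicPair (e : S) (f : S)), j e * j f = j (e.mul f h)) →
      ∃ F : T →ₙ* M, ∀ e, F (ι e) = j e

namespace IsFreeIG

open Idem

variable {S : Type v} [Semigroup S] {T : Type u} [Semigroup T] {ι : Idem S → T}

theorem isIdempotentElem (hι : IsFreeIG ι) (e : Idem S) : IsIdempotentElem (ι e) := by
  unfold IsIdempotentElem
  rw [hι.mul_of_basic e e (basic_of_mul_eq_left e.2), show e.mul e _ = e from Subtype.ext e.2]

theorem mul_eq_right (hι : IsFreeIG ι) {e f : Idem S} (h : (e : S) * f = f) :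
    ι e * ι f = ι f := by
  rw [hι.mul_of_basic e f (basic_of_mul_eq_right h), show e.mul f _ = f from Subtype.ext h]

theorem mul_eq_left (hι : IsFreeIG ι) {e f : Idem S} (h : (e : S) * f = e) :
    ι e * ι f = ι e := by
  rw [hι.mul_of_basic e f (basic_of_mul_eq_left h), show e.mul f _ = e from Subtype.ext h]

theorem induction_left (hι : IsFreeIG ι) {P : T → Prop} (of : ∀ e, P (ι e))
    (mul : ∀ e t, P t → P (ι e * t)) (t : T) : P t := by
  have ht : t ∈ Subsemigroup.closure (Set.range ι) := by rw [hι.closure_eq]; trivial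
  have key : P t ∧ ∀ s, P s → P (t * s) := by
    induction ht using Subsemigroup.closure_induction with
    | mem x hx =>
      obtain ⟨e, rfl⟩ := hx
      exact ⟨of e, mul e⟩
    | mul x y _ _ hx hy =>
      exact ⟨hx.2 _ hy.1, fun s hs => by rw [mul_assoc]; exact hx.2 _ (hy.2 s hs)⟩
  exact key.1

/-- If `g` fixes `a` and `e` acts regularly on the `R`-class of `g`, then `e a` is `L`-related to
`a` and the image of the `R`-class of `g` fixes it. -/
theorem strong_mul (hι : IsFreeIG ι) {e g h y : Idem S} {a : T} (ha : ι g * a = a)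
    (hg : rClass g = rClass h) (he : (h : S) * e = h) (hy : (y : S) = e * h) :
    ι y * (ι e * a) = ι e * a ∧ ι h * (ι e * a) = a := by
  have hha : ι h * a = a := by
    rw [← ha, ← mul_assoc, hι.mul_eq_right (rClass_eq_iff.1 hg).2]
  have hea : ι h * (ι e * a) = a := by rw [← mul_assoc, hι.mul_eq_left he, hha]
  refine ⟨?_, hea⟩
  have : y = e.mul h (basic_of_swap_eq_right he) := Subtype.ext hy
  rw [this, ← hι.mul_of_basic, mul_assoc, hea]

/-- Either `b`, which arises from `g` by multiplication on the left and acts on states as `G`, stays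
`L`-related to `g`, or the counter for some rank increases. -/
def Dichotomy (ι : Idem S → T) (g : Idem S) (b : T) (G : ℕ → ℕ → Option (RClass S) × ℕ) : Prop :=
  ∃ y : Idem S, (∀ d k, (G d k).1 = some (rClass y)) ∧
    (((∀ d k, (G d k).2 = k) ∧ ι y * b = b ∧ ∃ x, x * b = ι g) ∨
      ∃ d, (∀ k, k < (G d k).2) ∧ ∀ d' < d, ∀ k, (G d' k).2 = k)

theorem Dichotomy.mul (hι : IsFreeIG ι) {g : Idem S} {b : T}
    {G : ℕ → ℕ → Option (RClass S) × ℕ} (h : Dichotomy ι g b G) (e : Idem S) :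
    Dichotomy ι g (ι e * b) fun d k => act d e (G d k) := by
  obtain ⟨y, hy, h⟩ := h
  have hG : ∀ d k, G d k = (some (rClass y), (G d k).2) := fun d k => Prod.ext (hy d k) rfl
  by_cases H : Strong e (some (rClass y))
  · obtain ⟨x, hyx, hx⟩ := H
    have hact : ∀ d k, act d e (G d k) =
        (some (rClass (e.mul x (basic_of_swap_eq_right hx))), (G d k).2) := fun d k => by
      rw [hG, hyx, act_of_mul_eq d hx]
    refine ⟨e.mul x (basic_of_swap_eq_right hx), fun d k => congrArg Prod.fst (hact d k), ?_⟩
    simp only [hact]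
    refine h.imp_left fun ⟨h1, h2, z, hz⟩ => ?_
    obtain ⟨h3, h4⟩ := hι.strong_mul (y := e.mul x (basic_of_swap_eq_right hx)) h2
      (Option.some.inj hyx) hx rfl
    exact ⟨h1, h3, z * ι x, by rw [mul_assoc, h4, hz]⟩
  · have hact : ∀ d k, act d e (G d k) = (some (rClass e), bump d (rank e) (G d k).2) :=
      fun d k => by rw [hG, act_of_not_strong d H]
    refine ⟨e, fun d k => congrArg Prod.fst (hact d k), Or.inr ?_⟩
    simp only [hact]
    unfold bump
    rcases h with ⟨h1, _⟩ | ⟨d, h1, h2⟩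
    · refine ⟨rank e, fun k => by simp [h1], fun d' hd' k => ?_⟩
      rw [h1, if_neg (by omega), if_neg (by omega)]
    · rcases lt_or_ge (rank e) d with hd | hd
      · refine ⟨rank e, fun k => by simp [h2 _ hd], fun d' hd' k => ?_⟩
        rw [h2 _ (by omega), if_neg (by omega), if_neg (by omega)]
      · refine ⟨d, fun k => ?_, fun d' hd' k => ?_⟩
        · have := h1 k
          split_ifs <;> omega
        · rw [h2 _ hd', if_neg (by omega), if_neg (by omega)]

variable [Finite (Idem S)]

theorem exists_action (hι : IsFreeIG ι) (d : ℕ) :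
    ∃ F : T →ₙ* Function.End (Option (RClass S) × ℕ), ∀ e, F (ι e) = act d e :=
  hι.exists_lift (Function.End (Option (RClass S) × ℕ)) (act d) fun _ _ h => funext (act_act d h)

/-- The action of `IG(E(S))` on `R`-classes with a counter. -/
noncomputable def action (hι : IsFreeIG ι) (d : ℕ) :
    T →ₙ* Function.End (Option (RClass S) × ℕ) := (hι.exists_action d).choose

theorem action_of (hι : IsFreeIG ι) (d : ℕ) (e : Idem S) (p : Option (RClass S) × ℕ) :
    hι.action d (ι e) p = act d e p := congrFun ((hι.exists_action d).choose_spec e) p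

theorem action_mul (hι : IsFreeIG ι) (d : ℕ) (a b : T) (p : Option (RClass S) × ℕ) :
    hι.action d (a * b) p = hι.action d a (hι.action d b p) := by
  rw [map_mul]; rfl

/-- `g` represents the `R`-class attached to `a`. -/
def Represents (hι : IsFreeIG ι) (g : Idem S) (a : T) : Prop :=
  ι g * a = a ∧ ∀ d k, (hι.action d a (none, k)).1 = some (rClass g)

theorem exists_represents (hι : IsFreeIG ι) (a : T) : ∃ g, hι.Represents g a := by
  induction a using hι.induction_left with
  | of e =>
    refine ⟨e, hι.isIdempotentElem e, fun d k => ?_⟩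
    rw [action_of, act_of_not_strong]
    rintro ⟨h, hh, _⟩
    cases hh
  | mul e a ih =>
    obtain ⟨g, hga, hg⟩ := ih
    by_cases H : Strong e (some (rClass g))
    · obtain ⟨h, hgh, he⟩ := H
      refine ⟨e.mul h (basic_of_swap_eq_right he),
        (hι.strong_mul hga (Option.some.inj hgh) he rfl).1, fun d k => ?_⟩
      rw [action_mul, action_of, ← Prod.mk.eta (p := hι.action d a (none, k)), hg, hgh,
        act_of_mul_eq d he]
    · refine ⟨e, by rw [← mul_assoc, hι.isIdempotentElem e], fun d k => ?_⟩
      rw [action_mul, action_of, ← Prod.mk.eta (p := hι.action d a (none, k)), hg,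
        act_of_not_strong d H]

theorem dichotomy (hι : IsFreeIG ι) (a : T) (g : Idem S) :
    Dichotomy ι g (a * ι g) fun d k => hι.action d a (some (rClass g), k) := by
  induction a using hι.induction_left with
  | of e =>
    simp only [action_of]
    exact Dichotomy.mul hι ⟨g, fun _ _ => rfl, Or.inl ⟨fun _ _ => rfl, hι.isIdempotentElem g,
      ι g, hι.isIdempotentElem g⟩⟩ e
  | mul e a ih =>
    simp only [action_mul, action_of, mul_assoc]
    exact ih.mul hι e

/-- An idempotent that fixes `b` on the left also fixes the idempotent attached to `b`. -/
theorem Represents.mul_eq (hι : IsFreeIG ι) {g : Idem S} {b c : T} (hg : hι.Represents g b)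
    (hc : IsIdempotentElem c) (h : c * b = b) : c * ι g = ι g := by
  obtain ⟨y, hy, H⟩ := hι.dichotomy c g
  -- The counter starts at the value left by `b`, so that `c * b = b` makes `c` fix the whole state.
  have hfix : ∀ d, hι.action d c (some (rClass g), (hι.action d b (none, 0)).2) =
      (some (rClass g), (hι.action d b (none, 0)).2) := fun d => by
    have : (some (rClass g), (hι.action d b (none, 0)).2) = hι.action d b (none, 0) :=
      Prod.ext (hg.2 d 0).symm rfl
    rw [this, ← action_mul, h]
  rcases H with ⟨_, h2, x, hx⟩ | ⟨d, h1, _⟩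
  · have hgy : rClass g = rClass y := Option.some.inj
      ((congrArg Prod.fst (hfix 0)).symm.trans (hy 0 (hι.action 0 b (none, 0)).2))
    have hgc : ι g * (c * ι g) = c * ι g := by
      rw [← h2, ← mul_assoc, hι.mul_eq_right (rClass_eq_iff.1 hgy).1]
    have hcc : c * ι g * (c * ι g) = c * ι g := by
      rw [mul_assoc, hgc, ← mul_assoc, hc]
    calc c * ι g = ι g * (c * ι g) := hgc.symm
      _ = x * (c * ι g * (c * ι g)) := by rw [← mul_assoc x, hx]
      _ = ι g := by rw [hcc, hx]
  · exact absurd ((h1 _).trans_eq (congrArg Prod.snd (hfix d))) (lt_irrefl _)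

theorem Represents.rTilde (hι : IsFreeIG ι) {g : Idem S} {b : T} (hg : hι.Represents g b) :
    RTilde b (ι g) := fun c hc =>
  ⟨hg.mul_eq hι hc, fun h => by rw [← hg.1, ← mul_assoc, h]⟩

/-- After `a` or `ι g` the tracked class is that of `g`, and the counter never influences the class;
so `c` leads both to the same class, and their representatives are `R`-related. -/
theorem rTilde_mul (hι : IsFreeIG ι) {g : Idem S} {a : T} (hg : hι.Represents g a) (c : T) :
    RTilde (c * a) (c * ι g) := by
  obtain ⟨x, hx⟩ := hι.exists_represents (c * a)
  obtain ⟨z, hz⟩ := hι.exists_represents (c * ι g)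
  obtain ⟨y, hy, _⟩ := hι.dichotomy c g
  have key : ∀ {b : T} {w : Idem S}, (hι.action 0 b (none, 0)).1 = some (rClass g) →
      hι.Represents w (c * b) → rClass w = rClass y := fun {b w} hb hw => by
    have h1 := hw.2 0 0
    rw [action_mul, ← Prod.mk.eta (p := hι.action 0 b (none, 0)), hb] at h1
    exact Option.some.inj (h1.symm.trans (hy 0 _))
  have hgc : (hι.action 0 (ι g) (none, 0)).1 = some (rClass g) := by
    rw [action_of, act_of_not_strong]
    rintro ⟨h, hh, _⟩
    cases hh
  obtain ⟨hxz, hzx⟩ := rClass_eq_iff.1 ((key (hg.2 0 0) hx).trans (key hgc hz).symm)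
  intro e he
  rw [hx.rTilde hι e he, hz.rTilde hι e he]
  constructor <;> intro h
  · rw [← hι.mul_eq_right hxz, ← mul_assoc, h]
  · rw [← hι.mul_eq_right hzx, ← mul_assoc, h]

theorem exists_rTilde (hι : IsFreeIG ι) (a : T) : ∃ e : T, IsIdempotentElem e ∧ RTilde a e := by
  obtain ⟨g, hg⟩ := hι.exists_represents a
  exact ⟨ι g, hι.isIdempotentElem g, hg.rTilde hι⟩

theorem isLeftCongruence_rTilde (hι : IsFreeIG ι) : IsLeftCongruence (RTilde (S := T)) := by
  refine ⟨⟨fun _ _ _ => Iff.rfl, fun h e he => (h e he).symm,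
    fun h k e he => (h e he).trans (k e he)⟩, fun a b c hab => ?_⟩
  obtain ⟨x, hx⟩ := hι.exists_represents a
  obtain ⟨z, hz⟩ := hι.exists_represents b
  have hxz : RTilde (ι x) (ι z) := fun e he =>
    ((hx.rTilde hι e he).symm.trans (hab e he)).trans (hz.rTilde hι e he)
  -- On generators `R̃` amounts to mutual left fixing, which turns `c * ι x` into `c * ι z * ι x`.
  have h1 := (hxz _ (hι.isIdempotentElem x)).1 (hι.isIdempotentElem x)
  have h2 := (hxz _ (hι.isIdempotentElem z)).2 (hι.isIdempotentElem z)
  intro e he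
  rw [hι.rTilde_mul hx c e he, hι.rTilde_mul hz c e he]
  constructor <;> intro h
  · rw [← h1, ← mul_assoc c, ← mul_assoc e, h]
  · rw [← h2, ← mul_assoc c, ← mul_assoc e, h]

end IsFreeIG

/-! ### Left-right duality. -/

section Dual

open MulOpposite

variable {S : Type v} [Semigroup S] {T : Type u} [Semigroup T]

theorem IsIdempotentElem.unop_mulOpposite {e : Sᵐᵒᵖ} (he : IsIdempotentElem e) :
    IsIdempotentElem e.unop := congrArg unop he

theorem IsIdempotentElem.op_mulOpposite {e : S} (he : IsIdempotentElem e) :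
    IsIdempotentElem (op e) := congrArg op he

/-- The idempotents of the opposite semigroup. -/
def Idem.opEquiv : Idem Sᵐᵒᵖ ≃ Idem S where
  toFun e := ⟨unop e.1, e.2.unop_mulOpposite⟩
  invFun e := ⟨op e.1, e.2.op_mulOpposite⟩
  left_inv _ := rfl
  right_inv _ := rfl

theorem IsBasicPair.unop {e f : Sᵐᵒᵖ} (h : IsBasicPair e f) : IsBasicPair f.unop e.unop := by
  obtain ⟨x, hx, hx'⟩ := h
  refine ⟨x.unop, ?_, ?_⟩
  · rcases hx with rfl | rfl <;> simp
  · rcases hx' with rfl | rfl <;> simp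

theorem IsBasicPair.op {e f : S} (h : IsBasicPair e f) :
    IsBasicPair (MulOpposite.op f) (MulOpposite.op e) := by
  obtain ⟨x, hx, hx'⟩ := h
  refine ⟨MulOpposite.op x, ?_, ?_⟩
  · rcases hx with rfl | rfl <;> simp
  · rcases hx' with rfl | rfl <;> simp

/-- Basic pairs are symmetric, so reversing products in `S` and `T` together preserves all three
properties. -/
theorem IsFreeIG.op {ι : Idem S → T} (hι : IsFreeIG ι) :
    IsFreeIG fun e : Idem Sᵐᵒᵖ => MulOpposite.op (ι (Idem.opEquiv e)) where
  mul_of_basic e f h := congrArg MulOpposite.op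
    (hι.mul_of_basic (Idem.opEquiv f) (Idem.opEquiv e) h.unop)
  closure_eq := by
    refine eq_top_iff.2 fun x _ => ?_
    have hx : x.unop ∈ Subsemigroup.closure (Set.range ι) := by rw [hι.closure_eq]; trivial
    rw [← op_unop x]
    generalize x.unop = y at hx
    induction hx using Subsemigroup.closure_induction with
    | mem y hy =>
      obtain ⟨e, rfl⟩ := hy
      exact Subsemigroup.subset_closure ⟨Idem.opEquiv.symm e, rfl⟩
    | mul y z _ _ hy hz => rw [op_mul]; exact mul_mem hz hy
  exists_lift M _ j hj := by
    obtain ⟨F, hF⟩ := hι.exists_lift Mᵐᵒᵖ (fun e => MulOpposite.op (j (Idem.opEquiv.symm e)))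
      fun e f h => congrArg MulOpposite.op (hj _ _ h.op)
    refine ⟨⟨fun t => (F t.unop).unop, fun s t => ?_⟩, fun e => ?_⟩
    · rw [MulOpposite.unop_mul, map_mul, MulOpposite.unop_mul]
    · exact congrArg MulOpposite.unop (hF (Idem.opEquiv e))

theorem lTilde_iff_rTilde_op {a b : T} : LTilde a b ↔ RTilde (op a) (op b) := by
  constructor
  · intro h e he
    have := h e.unop he.unop_mulOpposite
    rwa [← op_inj, ← op_inj (x := b * _), op_mul, op_mul, op_unop] at this
  · intro h e he
    have := h (op e) he.op_mulOpposite
    rwa [← op_mul, ← op_mul, op_inj, op_inj] at this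

theorem IsFreeIG.isFountain [Finite (Idem S)] {ι : Idem S → T} (hι : IsFreeIG ι) :
    IsFountain T := by
  have : Finite (Idem Sᵐᵒᵖ) := Finite.of_equiv _ Idem.opEquiv.symm
  refine ⟨hι.exists_rTilde, fun a => ?_⟩
  obtain ⟨e, he, h⟩ := hι.op.exists_rTilde (MulOpposite.op a)
  exact ⟨e.unop, he.unop_mulOpposite, lTilde_iff_rTilde_op.2 h⟩

theorem IsFreeIG.congruenceCondition [Finite (Idem S)] {ι : Idem S → T} (hι : IsFreeIG ι) :
    CongruenceCondition T := by
  have : Finite (Idem Sᵐᵒᵖ) := Finite.of_equiv _ Idem.opEquiv.symm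
  refine ⟨hι.isLeftCongruence_rTilde, ⟨fun _ _ _ => Iff.rfl, fun h e he => (h e he).symm,
    fun h k e he => (h e he).trans (k e he)⟩, fun a b c hab => ?_⟩
  rw [lTilde_iff_rTilde_op] at hab ⊢
  exact hι.op.isLeftCongruence_rTilde.2 _ _ (MulOpposite.op c) hab

end Dual

/-! ### The presentation has the properties used. -/

theorem isFreeIG_of_equiv {E : Type u} (op : PartialBinOp E) {S : Type v} [Semigroup S]
    (φ : E ≃ Idem S) (hφ : ∀ e f g : E, g ∈ op e f ↔ φ g ∈ biorder S (φ e) (φ f)) :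
    IsFreeIG fun s : Idem S => ((FreeSemigroup.of (φ.symm s) : FreeSemigroup E) : IG op) where
  mul_of_basic e f h := by
    refine (Con.eq _).2 (ConGen.Rel.of _ _ ⟨_, _, _, ?_, rfl, rfl⟩)
    rw [hφ]
    simp only [Equiv.apply_symm_apply]
    exact ⟨h, rfl⟩
  closure_eq := by
    refine (Subsemigroup.eq_top_iff' _).2 fun x => ?_
    induction x using Con.induction_on with
    | H w =>
      induction w using FreeSemigroup.recOnMul with
      | ih1 e => exact Subsemigroup.subset_closure ⟨φ e, by simp⟩
      | ih2 e w he hw => rw [Con.coe_mul]; exact mul_mem he hw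
  exists_lift M _ j hj := by
    have key : conGen (igRel op) ≤ Con.ker (FreeSemigroup.lift fun e => j (φ e)) := by
      refine Con.conGen_le.2 ?_
      rintro _ _ ⟨e, f, g, hg, rfl, rfl⟩
      obtain ⟨h, hg⟩ := (hφ e f g).1 hg
      rw [Con.ker_rel, map_mul, FreeSemigroup.lift_of, FreeSemigroup.lift_of,
        FreeSemigroup.lift_of, hj _ _ h]
      exact congrArg j hg
    refine ⟨⟨fun t => Con.liftOn t (FreeSemigroup.lift fun e => j (φ e)) fun _ _ h => key h,
      fun s t => ?_⟩, fun e => ?_⟩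
    · induction s, t using Con.induction_on₂ with
      | H s t => exact map_mul (FreeSemigroup.lift fun e => j (φ e)) s t
    · change FreeSemigroup.lift (fun e => j (φ e)) (FreeSemigroup.of (φ.symm e)) = j e
      rw [FreeSemigroup.lift_of, Equiv.apply_symm_apply]

theorem mainTheorem9 {E : Type u} [Finite E] (op : PartialBinOp E)
    (hop : IsBiorderedSet.{u, v} op) :
    IsFountain (IG op) ∧ CongruenceCondition (IG op) := by
  obtain ⟨S, _, φ, hφ⟩ := hop
  have : Finite (Idem S) := Finite.of_equiv _ φ
  have hι := isFreeIG_of_equiv op φ hφ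
  exact ⟨hι.isFountain, hι.congruenceCondition⟩
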